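/- Let $n,k\ge 1$ be integers, let $z_1,\dots,z_n$ be distinct nonzero points of the open unit disk $\mathbb D$, and let $W_1,\dots,W_n$ be complex $k\times k$ matrices. The problem **MCNP** for these data is to find a holomorphic $k\times k$ matrix function $S$ on $\mathbb D$ with $\sup_{z\in\mathbb D}\|S(z)\|\le 1$ (operator norm), $S'(0)=0$ and $S(z_j)=W_j$ for $j=1,\dots,n$. Put $$\mathbb P=\left[\frac{I_k-W_iW_j^*}{1-z_i\overline{z}_j}\right]_{i,j=1}^n,\quad Z=\operatorname{diag}(z_1I_k,\dots,z_nI_k),\quad E=\begin{bmatrix}I_k\\ \vdots\\ I_k\end{bmatrix},\quad W=\begin{bmatrix}W_1\\ \vdots\\ W_n\end{bmatrix},$$ $$\widetilde E=\begin{bmatrix}E& ZE\end{bmatrix},\qquad \widetilde W=\begin{bmatrix}W& ZW\end{bmatrix}.$$ Assume that $\mathbb P$ is positive definite and that the $4k\times 4k$ matrix $$M=\begin{bmatrix}I-\widetilde E^*\mathbb P^{-1}\widetilde E& -\widetilde E^*\mathbb P^{-1}\widetilde W\\ -\widetilde W^*\mathbb P^{-1}\widetilde E& -(I+\widetilde W^*\mathbb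 P^{-1}\widetilde W)\end{bmatrix}$$ is invertible. Set $$\Lambda=I-\widetilde E^*(\mathbb P+\widetilde W\widetilde W^*)^{-1}\widetilde E,\qquad C=-\widetilde E^*(\mathbb P+\widetilde W\widetilde W^*)^{-1}\widetilde W,$$ $$L=\Lambda,\qquad R=I-\widetilde W^*(\mathbb P+\widetilde W\widetilde W^*)^{-1}\widetilde W.$$ Then MCNP has a solution if and only if (1) $\Lambda$ is positive definite, and (2) there is a $2k\times 2k$ matrix $K$ with $\|K\|\le 1$ such that $$C+L^{1/2}KR^{1/2}=\begin{bmatrix}X&0\\0&X\end{bmatrix}$$ for some $k\times k$ matrix $X$, where $L^{1/2}$ and $R^{1/2}$ are the positive semidefinite square roots. -/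

import Mathlib

open scoped ComplexOrder MatrixOrder

noncomputable section

namespace ConstrainedNP

/-- A square complex matrix is contractive if its operator norm with respect to the Euclidean
norm is at most one. -/
def IsContractive {ι : Type} [Fintype ι] [DecidableEq ι] (A : Matrix ι ι ℂ) : Prop :=
  ‖Matrix.toEuclideanCLM (n := ι) (𝕜 := ℂ) A‖ ≤ 1

/-- The `k × k` matrix-valued constrained Schur class: (restrictions to the open unit disk of)
matrix functions with holomorphic entries, with supremum norm at most one on the disk, and with
vanishing derivative at the origin. -/
def constrainedSchurClass (k : ℕ) : Set (ℂ → Matrix (Fin k) (Fin k) ℂ) :=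
  {S | (∀ i j, DifferentiableOn ℂ (fun z => S z i j) (Metric.ball 0 1)) ∧
    (∀ z ∈ Metric.ball (0 : ℂ) 1, IsContractive (S z)) ∧
    ∀ i j, deriv (fun z => S z i j) 0 = 0}

variable {n k : ℕ}

/-- The matrix-valued constrained Nevanlinna-Pick problem with nodes `z` and values `w`
has a solution. -/
def MCNPSolvable (z : Fin n → ℂ) (w : Fin n → Matrix (Fin k) (Fin k) ℂ) : Prop :=
  ∃ S ∈ constrainedSchurClass k, ∀ j, S (z j) = w j

/-- The Pick matrix, with `(i, j)` block `(1 - z i * conj (z j))⁻¹ • (I - w i * (w j)ᴴ)`. -/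
def pick (z : Fin n → ℂ) (w : Fin n → Matrix (Fin k) (Fin k) ℂ) :
    Matrix (Fin n × Fin k) (Fin n × Fin k) ℂ :=
  Matrix.of fun p q =>
    (1 - w p.1 * (w q.1).conjTranspose) p.2 q.2 / (1 - z p.1 * star (z q.1))

/-- `Z`, the block diagonal matrix with diagonal blocks `z i • I`. -/
def matZ (k : ℕ) (z : Fin n → ℂ) : Matrix (Fin n × Fin k) (Fin n × Fin k) ℂ :=
  Matrix.diagonal fun p => z p.1

/-- `E`, the block column with all blocks equal to the identity. -/
def matE (n k : ℕ) : Matrix (Fin n × Fin k) (Fin k) ℂ :=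
  Matrix.of fun p j => (1 : Matrix (Fin k) (Fin k) ℂ) p.2 j

/-- `W`, the block column with blocks `w i`. -/
def matW (w : Fin n → Matrix (Fin k) (Fin k) ℂ) : Matrix (Fin n × Fin k) (Fin k) ℂ :=
  Matrix.of fun p j => w p.1 p.2 j

/-- `Ẽ = [E, Z E]`. -/
def tildeE (k : ℕ) (z : Fin n → ℂ) : Matrix (Fin n × Fin k) (Fin k ⊕ Fin k) ℂ :=
  Matrix.fromCols (matE n k) (matZ k z * matE n k)

/-- `W̃ = [W, Z W]`. -/
def tildeW (z : Fin n → ℂ) (w : Fin n → Matrix (Fin k) (Fin k) ℂ) :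
    Matrix (Fin n × Fin k) (Fin k ⊕ Fin k) ℂ :=
  Matrix.fromCols (matW w) (matZ k z * matW w)

/-- The `4k × 4k` matrix `M`. -/
def matM (z : Fin n → ℂ) (w : Fin n → Matrix (Fin k) (Fin k) ℂ) :
    Matrix ((Fin k ⊕ Fin k) ⊕ (Fin k ⊕ Fin k)) ((Fin k ⊕ Fin k) ⊕ (Fin k ⊕ Fin k)) ℂ :=
  Matrix.fromBlocks
    (1 - (tildeE k z).conjTranspose * (pick z w)⁻¹ * tildeE k z)
    (-((tildeE k z).conjTranspose * (pick z w)⁻¹ * tildeW z w))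
    (-((tildeW z w).conjTranspose * (pick z w)⁻¹ * tildeE k z))
    (-(1 + (tildeW z w).conjTranspose * (pick z w)⁻¹ * tildeW z w))

/-- `P + W̃ W̃ᴴ`. -/
def matQ (z : Fin n → ℂ) (w : Fin n → Matrix (Fin k) (Fin k) ℂ) :
    Matrix (Fin n × Fin k) (Fin n × Fin k) ℂ :=
  pick z w + tildeW z w * (tildeW z w).conjTranspose

/-- `Λ = I - Ẽᴴ (P + W̃ W̃ᴴ)⁻¹ Ẽ`. -/
def matLambda (z : Fin n → ℂ) (w : Fin n → Matrix (Fin k) (Fin k) ℂ) :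
    Matrix (Fin k ⊕ Fin k) (Fin k ⊕ Fin k) ℂ :=
  1 - (tildeE k z).conjTranspose * (matQ z w)⁻¹ * tildeE k z

/-- The center `C = -Ẽᴴ (P + W̃ W̃ᴴ)⁻¹ W̃` of the matrix ball. -/
def ballCenter (z : Fin n → ℂ) (w : Fin n → Matrix (Fin k) (Fin k) ℂ) :
    Matrix (Fin k ⊕ Fin k) (Fin k ⊕ Fin k) ℂ :=
  -((tildeE k z).conjTranspose * (matQ z w)⁻¹ * tildeW z w)

/-- The left semi-radius `L = Λ` of the matrix ball. -/
def ballLeft (z : Fin n → ℂ) (w : Fin n → Matrix (Fin k) (Fin k) ℂ) :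
    Matrix (Fin k ⊕ Fin k) (Fin k ⊕ Fin k) ℂ :=
  matLambda z w

/-- The right semi-radius `R = I - W̃ᴴ (P + W̃ W̃ᴴ)⁻¹ W̃` of the matrix ball. -/
def ballRight (z : Fin n → ℂ) (w : Fin n → Matrix (Fin k) (Fin k) ℂ) :
    Matrix (Fin k ⊕ Fin k) (Fin k ⊕ Fin k) ℂ :=
  1 - (tildeW z w).conjTranspose * (matQ z w)⁻¹ * tildeW z w

/-- The point `C + L^{1/2} K R^{1/2}` of the matrix ball. Here `CFC.sqrt` is the positive
semidefinite square root of a positive semidefinite matrix. -/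
def ballPoint (z : Fin n → ℂ) (w : Fin n → Matrix (Fin k) (Fin k) ℂ)
    (K : Matrix (Fin k ⊕ Fin k) (Fin k ⊕ Fin k) ℂ) :
    Matrix (Fin k ⊕ Fin k) (Fin k ⊕ Fin k) ℂ :=
  ballCenter z w + CFC.sqrt (ballLeft z w) * K * CFC.sqrt (ballRight z w)

end ConstrainedNP

end

namespace ConstrainedNP

open Matrix

/-! Prescribing the unknown value `X = S 0` turns the condition `S' 0 = 0` into interpolation data
at the origin, with an associated Pick matrix `extPick z w X`. The theorem combines two equivalences
through the statement that `extPick z w X` is positive semidefinite for some `X`.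

Analytic half (`mcnpSolvable_iff_exists_extPick_posSemidef`). From `X` to `S`: a factorization `G *
Gᴴ` of the extended Pick matrix and its Stein equation `extPick_stein` give two block rows with
equal Gram matrices. A unitary colligation links them, and its transfer function solves the problem
(lurking isometry). From `S` to `X`: the extended Pick matrix is a circle average of positive
semidefinite matrices built from Szegő kernels (`posSemidef_pickKernel`), after a dilation that
moves `S` off the boundary.

Algebraic half (`exists_ballPoint_iff_exists_extPick_posSemidef`). Since `pick z w` is positive
definite, positivity of `extPick` is that of its Schur complement. Completing the square in `X`
gives a matrix ball inequality with semi-radii `Λ` and `R`. Invertibility of `M` is invertibility of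
`Λ`, which makes `Λ` positive definite. -/

theorem star_dotProduct_self_eq_norm_sq {ι : Type} [Fintype ι] (x : ι → ℂ) :
    star x ⬝ᵥ x = ((‖WithLp.toLp 2 x‖ ^ 2 : ℝ) : ℂ) := by
  rw [dotProduct_comm, ← EuclideanSpace.inner_toLp_toLp, inner_self_eq_norm_sq_to_K]
  push_cast; rfl

/-! ### Contractions and isometric extension -/

section Contractive

variable {ι κ : Type} [Fintype ι] [DecidableEq ι] [Fintype κ] [DecidableEq κ]

theorem isContractive_iff_conjTranspose_mul_self (A : Matrix ι ι ℂ) :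
    IsContractive A ↔ (1 - Aᴴ * A).PosSemidef := by
  have key (x : ι → ℂ) : star x ⬝ᵥ ((1 - Aᴴ * A) *ᵥ x) =
      ((‖WithLp.toLp 2 x‖ ^ 2 - ‖WithLp.toLp 2 (A *ᵥ x)‖ ^ 2 : ℝ) : ℂ) := by
    rw [sub_mulVec, one_mulVec, dotProduct_sub, ← mulVec_mulVec, dotProduct_mulVec,
      ← star_mulVec, star_dotProduct_self_eq_norm_sq, star_dotProduct_self_eq_norm_sq]
    push_cast; rfl
  have hherm : (1 - Aᴴ * A).IsHermitian :=
    isHermitian_one.sub (isHermitian_conjTranspose_mul_self A)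
  rw [IsContractive, posSemidef_iff_dotProduct_mulVec, and_iff_right hherm,
    ContinuousLinearMap.opNorm_le_iff zero_le_one]
  simp only [key, one_mul]
  constructor
  · intro h x
    have := h (WithLp.toLp 2 x)
    rw [toEuclideanCLM_toLp] at this
    exact_mod_cast sub_nonneg.2 (pow_le_pow_left₀ (norm_nonneg _) this 2)
  · intro h x
    have := h x.ofLp
    have h2 : (0 : ℝ) ≤ ‖WithLp.toLp 2 x.ofLp‖ ^ 2 - ‖WithLp.toLp 2 (A *ᵥ x.ofLp)‖ ^ 2 := by
      exact_mod_cast this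
    have h3 := pow_le_pow_iff_left₀ (norm_nonneg _) (norm_nonneg _) two_ne_zero |>.1
      (sub_nonneg.1 h2)
    simpa [← toEuclideanCLM_toLp] using h3

theorem isContractive_conjTranspose_iff (A : Matrix ι ι ℂ) :
    IsContractive Aᴴ ↔ IsContractive A := by
  rw [IsContractive, IsContractive, ← star_eq_conjTranspose, map_star, norm_star]

theorem isContractive_iff_mul_conjTranspose_self (A : Matrix ι ι ℂ) :
    IsContractive A ↔ (1 - A * Aᴴ).PosSemidef := by
  rw [← isContractive_conjTranspose_iff, isContractive_iff_conjTranspose_mul_self,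
    conjTranspose_conjTranspose]

theorem isContractive_neg_iff (A : Matrix ι ι ℂ) : IsContractive (-A) ↔ IsContractive A := by
  rw [IsContractive, IsContractive, map_neg, norm_neg]

/-- Two matrices with the same row Gram matrix differ by a unitary factor. -/
theorem exists_unitary_of_mul_conjTranspose_eq (A B : Matrix ι κ ℂ) (h : A * Aᴴ = B * Bᴴ) :
    ∃ U : Matrix κ κ ℂ, Uᴴ * U = 1 ∧ B * U = A := by
  let a := (toEuclideanLin (𝕜 := ℂ) Aᴴ)
  let b := (toEuclideanLin (𝕜 := ℂ) Bᴴ)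
  have hn (y) : ‖a y‖ = ‖b y‖ := by
    have e (C : Matrix ι κ ℂ) : ((‖toEuclideanLin (𝕜 := ℂ) Cᴴ y‖ ^ 2 : ℝ) : ℂ) =
        star y.ofLp ⬝ᵥ ((C * Cᴴ) *ᵥ y.ofLp) := by
      rw [toLpLin_apply, ← star_dotProduct_self_eq_norm_sq, star_mulVec,
        ← dotProduct_mulVec, mulVec_mulVec, conjTranspose_conjTranspose]
    have := (e A).trans ((congrArg (fun M => star y.ofLp ⬝ᵥ (M *ᵥ y.ofLp)) h).trans (e B).symm)
    exact (pow_left_inj₀ (norm_nonneg _) (norm_nonneg _) two_ne_zero).1 (by exact_mod_cast this)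
  -- The map `b y ↦ a y` on the range of `b` is defined through a linear section `s` of `b`. By `hn`
  -- it does not depend on the section and preserves norms, so it extends to an isometry of the
  -- whole finite-dimensional space.
  obtain ⟨s, hs⟩ := b.rangeRestrict.exists_rightInverse_of_surjective b.range_rangeRestrict
  have hs' (v : LinearMap.range b) : b (s v) = v := by
    simpa using congrArg Subtype.val (LinearMap.congr_fun hs v)
  let T : LinearMap.range b →ₗᵢ[ℂ] EuclideanSpace ℂ κ :=
    { toLinearMap := a ∘ₗ s
      norm_map' := fun v => by
        change ‖a (s v)‖ = ‖v‖
        rw [hn, hs']; rfl }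
  have hT (y) : T.extend (b y) = a y := by
    have h1 := T.extend_apply ⟨b y, LinearMap.mem_range_self b y⟩
    refine h1.trans ?_
    change a (s _) = a y
    rw [← sub_eq_zero, ← map_sub, ← norm_eq_zero, hn, map_sub, hs', sub_self, norm_zero]
  let V : Matrix κ κ ℂ := toEuclideanLin.symm T.extend.toLinearMap
  have hV (x) : WithLp.toLp 2 (V *ᵥ x) = T.extend (WithLp.toLp 2 x) := by
    have : toEuclideanLin V = T.extend.toLinearMap := LinearEquiv.apply_symm_apply _ _
    exact LinearMap.congr_fun this (WithLp.toLp 2 x)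
  have hVB : V * Bᴴ = Aᴴ := by
    refine ext_of_mulVec_single fun i => ?_
    rw [← mulVec_mulVec]
    apply WithLp.toLp_injective 2
    rw [hV]
    exact hT (WithLp.toLp 2 (Pi.single i 1))
  have hVV : Vᴴ * V = 1 := by
    refine ext_of_mulVec_single fun i => ?_
    refine dotProduct_eq _ _ fun w => ?_
    have h1 := T.extend.inner_map_map (WithLp.toLp 2 (star w)) (WithLp.toLp 2 (Pi.single i 1))
    rw [← hV, ← hV, EuclideanSpace.inner_toLp_toLp, EuclideanSpace.inner_toLp_toLp, star_star,
      star_mulVec, star_star, dotProduct_comm, ← dotProduct_mulVec, mulVec_mulVec] at h1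
    rw [one_mulVec, ← h1, dotProduct_comm]
  refine ⟨Vᴴ, ?_, ?_⟩
  · rw [conjTranspose_conjTranspose, mul_eq_one_comm, hVV]
  · rw [← conjTranspose_inj, conjTranspose_mul, conjTranspose_conjTranspose, hVB]

end Contractive

/-! ### Schur complements and matrix balls -/

section MatrixBall

variable {N m : Type} [Fintype N] [DecidableEq N] [Fintype m] [DecidableEq m]
variable {P : Matrix N N ℂ} (e v : Matrix N m ℂ)

theorem posDef_one_add_conjTranspose_mul_inv_mul (hP : P.PosDef) :
    (1 + vᴴ * P⁻¹ * v).PosDef :=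
  PosDef.one.add_posSemidef (hP.inv.posSemidef.conjTranspose_mul_mul_same v)

theorem inv_one_add_conjTranspose_mul_inv_mul (hP : P.PosDef) :
    (1 + vᴴ * P⁻¹ * v)⁻¹ = 1 - vᴴ * (P + v * vᴴ)⁻¹ * v := by
  have hQ : (P + v * vᴴ).PosDef := hP.add_posSemidef (posSemidef_self_mul_conjTranspose v)
  have hPP : P⁻¹⁻¹ = P := nonsing_inv_nonsing_inv P ((isUnit_iff_isUnit_det P).1 hP.isUnit)
  have := add_mul_mul_inv_eq_sub (1 : Matrix m m ℂ) vᴴ P⁻¹ v isUnit_one hP.inv.isUnit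
    (by simpa [hPP] using hQ.isUnit)
  simpa [hPP] using this

theorem inv_add_mul_conjTranspose (hP : P.PosDef) :
    (P + v * vᴴ)⁻¹ = P⁻¹ - P⁻¹ * v * (1 + vᴴ * P⁻¹ * v)⁻¹ * vᴴ * P⁻¹ := by
  have := add_mul_mul_inv_eq_sub P v 1 vᴴ hP.isUnit isUnit_one
    (by simpa using (posDef_one_add_conjTranspose_mul_inv_mul v hP).isUnit)
  simpa using this

theorem inv_add_mul_conjTranspose_mul (hP : P.PosDef) :
    (P + v * vᴴ)⁻¹ * v = P⁻¹ * v * (1 + vᴴ * P⁻¹ * v)⁻¹ := by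
  have hB := (isUnit_iff_isUnit_det _).1 (posDef_one_add_conjTranspose_mul_inv_mul v hP).isUnit
  have h2 : vᴴ * P⁻¹ * v = (1 + vᴴ * P⁻¹ * v) - 1 := by abel
  rw [inv_add_mul_conjTranspose v hP, Matrix.sub_mul]
  have h3 : P⁻¹ * v * (1 + vᴴ * P⁻¹ * v)⁻¹ * vᴴ * P⁻¹ * v =
      P⁻¹ * v * ((1 + vᴴ * P⁻¹ * v)⁻¹ * (vᴴ * P⁻¹ * v)) := by simp only [Matrix.mul_assoc]
  rw [h3]
  nth_rw 2 [h2]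
  rw [Matrix.mul_sub, nonsing_inv_mul _ hB, Matrix.mul_sub]
  simp

/-- Completion of the square in the Schur complement of the extended Pick matrix. -/
theorem schurComplement_eq_ball (hP : P.PosDef) (X : Matrix m m ℂ) :
    (1 - X * Xᴴ) - (e - v * Xᴴ)ᴴ * P⁻¹ * (e - v * Xᴴ) =
      (1 - eᴴ * (P + v * vᴴ)⁻¹ * e) - (X - eᴴ * (P + v * vᴴ)⁻¹ * v) * (1 + vᴴ * P⁻¹ * v) *
        (X - eᴴ * (P + v * vᴴ)⁻¹ * v)ᴴ := by
  have hPB := posDef_one_add_conjTranspose_mul_inv_mul v hP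
  have hB := (isUnit_iff_isUnit_det _).1 hPB.isUnit
  have h1 : eᴴ * (P + v * vᴴ)⁻¹ * v = (eᴴ * P⁻¹ * v) * (1 + vᴴ * P⁻¹ * v)⁻¹ := by
    rw [Matrix.mul_assoc, inv_add_mul_conjTranspose_mul v hP]; simp only [Matrix.mul_assoc]
  have h2 : eᴴ * (P + v * vᴴ)⁻¹ * e = eᴴ * P⁻¹ * e -
      (eᴴ * P⁻¹ * v) * (1 + vᴴ * P⁻¹ * v)⁻¹ * (vᴴ * P⁻¹ * e) := by
    rw [inv_add_mul_conjTranspose v hP, Matrix.mul_sub, Matrix.sub_mul]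
    simp only [Matrix.mul_assoc]
  have h3 : (eᴴ * P⁻¹ * v)ᴴ = vᴴ * P⁻¹ * e := by
    simp [conjTranspose_mul, hP.inv.1.eq, Matrix.mul_assoc]
  have h4 : (e - v * Xᴴ)ᴴ * P⁻¹ * (e - v * Xᴴ) = eᴴ * P⁻¹ * e - eᴴ * P⁻¹ * v * Xᴴ
      - X * (vᴴ * P⁻¹ * e) + X * (vᴴ * P⁻¹ * v) * Xᴴ := by
    simp only [conjTranspose_sub, conjTranspose_mul, conjTranspose_conjTranspose, Matrix.sub_mul,
      Matrix.mul_sub, Matrix.mul_assoc]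
    abel
  rw [h1, h2, h4, conjTranspose_sub, conjTranspose_mul, h3, hPB.inv.1.eq]
  generalize eᴴ * P⁻¹ * v = D
  generalize vᴴ * P⁻¹ * e = D'
  have hH : vᴴ * P⁻¹ * v = (1 + vᴴ * P⁻¹ * v) - 1 := by abel
  generalize 1 + vᴴ * P⁻¹ * v = B at *
  rw [hH]
  have e1 : (X - D * B⁻¹) * B = X * B - D := by
    rw [Matrix.sub_mul, Matrix.mul_assoc, nonsing_inv_mul _ hB, Matrix.mul_one]
  rw [e1]
  have e2 : X * B * (B⁻¹ * D') = X * D' := by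
    rw [Matrix.mul_assoc, ← Matrix.mul_assoc B, mul_nonsing_inv _ hB, Matrix.one_mul]
  simp only [Matrix.sub_mul, Matrix.mul_sub, e2]
  simp only [Matrix.mul_assoc, Matrix.mul_one]
  abel

/-- Solvability of the parametrisation of a matrix ball with invertible semi-radii. -/
theorem exists_isContractive_iff_posSemidef {L R : Matrix m m ℂ} (hL : L.PosDef) (hR : R.PosDef)
    (Y : Matrix m m ℂ) :
    (∃ K, IsContractive K ∧ CFC.sqrt L * K * CFC.sqrt R = Y) ↔
      (L - Y * R⁻¹ * Yᴴ).PosSemidef := by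
  have sL : (CFC.sqrt L)ᴴ = CFC.sqrt L := (nonneg_iff_posSemidef.1 (CFC.sqrt_nonneg L)).1
  have sR : (CFC.sqrt R)ᴴ = CFC.sqrt R := (nonneg_iff_posSemidef.1 (CFC.sqrt_nonneg R)).1
  have qL : CFC.sqrt L * CFC.sqrt L = L :=
    CFC.sqrt_mul_sqrt_self L (nonneg_iff_posSemidef.2 hL.posSemidef)
  have qR : CFC.sqrt R * CFC.sqrt R = R :=
    CFC.sqrt_mul_sqrt_self R (nonneg_iff_posSemidef.2 hR.posSemidef)
  generalize CFC.sqrt L = l at *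
  generalize CFC.sqrt R = r at *
  have ul : IsUnit l.det := by
    have := (isUnit_iff_isUnit_det L).1 hL.isUnit
    rw [← qL, det_mul] at this
    exact isUnit_of_mul_isUnit_left this
  have ur : IsUnit r.det := by
    have := (isUnit_iff_isUnit_det R).1 hR.isUnit
    rw [← qR, det_mul] at this
    exact isUnit_of_mul_isUnit_left this
  -- With `Y = l * K * r` the ball inequality is a congruence by the invertible `l` of `1 - K * Kᴴ ≥
  -- 0`.
  have key (K : Matrix m m ℂ) : L - (l * K * r) * R⁻¹ * (l * K * r)ᴴ = lᴴ * (1 - K * Kᴴ) * l := by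
    have h1 : r * R⁻¹ * r = 1 := by
      rw [← qR, Matrix.mul_inv_rev, ← Matrix.mul_assoc, mul_nonsing_inv _ ur, Matrix.one_mul,
        nonsing_inv_mul _ ur]
    have h2 : (l * K * r) * R⁻¹ * (l * K * r)ᴴ = l * K * (r * R⁻¹ * r) * Kᴴ * l := by
      simp only [conjTranspose_mul, sL, sR, Matrix.mul_assoc]
    rw [h2, h1, sL, Matrix.mul_sub, Matrix.sub_mul, Matrix.mul_one, Matrix.mul_one, qL]
    simp only [Matrix.mul_assoc]
  constructor
  · rintro ⟨K, hK, rfl⟩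
    rw [key]
    exact ((isContractive_iff_mul_conjTranspose_self K).1 hK).conjTranspose_mul_mul_same l
  · intro h
    have hY : l * (l⁻¹ * Y * r⁻¹) * r = Y := by
      rw [← Matrix.mul_assoc, ← Matrix.mul_assoc, mul_nonsing_inv _ ul, Matrix.one_mul,
        Matrix.mul_assoc, nonsing_inv_mul _ ur, Matrix.mul_one]
    refine ⟨l⁻¹ * Y * r⁻¹, ?_, hY⟩
    rw [isContractive_iff_mul_conjTranspose_self]
    rw [← hY, key] at h
    have := h.conjTranspose_mul_mul_same l⁻¹
    rwa [Matrix.mul_assoc, Matrix.mul_assoc, mul_nonsing_inv _ ul, Matrix.mul_one,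
      ← Matrix.mul_assoc, ← conjTranspose_mul, mul_nonsing_inv _ ul, conjTranspose_one,
      Matrix.one_mul] at this

/-- The lower right block is minus a positive definite matrix, hence invertible. Its Schur
complement is the matrix on the right, by the Woodbury formula. -/
theorem isUnit_fromBlocks_ball_iff (hP : P.PosDef) :
    IsUnit (fromBlocks (1 - eᴴ * P⁻¹ * e) (-(eᴴ * P⁻¹ * v)) (-(vᴴ * P⁻¹ * e))
      (-(1 + vᴴ * P⁻¹ * v))) ↔ IsUnit (1 - eᴴ * (P + v * vᴴ)⁻¹ * e) := by
  have hPB := posDef_one_add_conjTranspose_mul_inv_mul v hP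
  obtain ⟨_⟩ := hPB.isUnit.neg.nonempty_invertible
  rw [isUnit_fromBlocks_iff_of_invertible₂₂, invOf_eq_nonsing_inv]
  have hn : (-(1 + vᴴ * P⁻¹ * v))⁻¹ = -(1 + vᴴ * P⁻¹ * v)⁻¹ := by
    apply inv_eq_right_inv
    rw [neg_mul_neg, mul_nonsing_inv _ ((isUnit_iff_isUnit_det _).1 hPB.isUnit)]
  rw [hn, inv_add_mul_conjTranspose v hP]
  congr! 1
  simp only [Matrix.mul_sub, Matrix.sub_mul, Matrix.mul_neg, Matrix.neg_mul, Matrix.mul_assoc]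
  abel

end MatrixBall

/-! ### The extended Pick matrix and its matrix ball -/

section ExtendedPick

variable {n k : ℕ}

/-- The Pick matrix of the interpolation problem with the additional conditions `S 0 = X` and
`S' 0 = 0`. -/
noncomputable def extPick (z : Fin n → ℂ) (w : Fin n → Matrix (Fin k) (Fin k) ℂ)
    (X : Matrix (Fin k) (Fin k) ℂ) :
    Matrix ((Fin n × Fin k) ⊕ (Fin k ⊕ Fin k)) ((Fin n × Fin k) ⊕ (Fin k ⊕ Fin k)) ℂ :=
  fromBlocks (pick z w) (tildeE k z - tildeW z w * (fromBlocks X 0 0 X)ᴴ)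
    (tildeE k z - tildeW z w * (fromBlocks X 0 0 X)ᴴ)ᴴ
    (1 - fromBlocks X 0 0 X * (fromBlocks X 0 0 X)ᴴ)

theorem extPick_posSemidef_iff {z : Fin n → ℂ} {w : Fin n → Matrix (Fin k) (Fin k) ℂ}
    (hP : (pick z w).PosDef) (X : Matrix (Fin k) (Fin k) ℂ) :
    (extPick z w X).PosSemidef ↔
      (matLambda z w - (fromBlocks X 0 0 X + ballCenter z w) * (ballRight z w)⁻¹ *
        (fromBlocks X 0 0 X + ballCenter z w)ᴴ).PosSemidef := by
  obtain ⟨_⟩ := hP.isUnit.nonempty_invertible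
  have hB := (isUnit_iff_isUnit_det _).1
    (posDef_one_add_conjTranspose_mul_inv_mul (tildeW z w) hP).isUnit
  rw [extPick, PosDef.fromBlocks₁₁ _ _ hP, schurComplement_eq_ball _ _ hP, matLambda, ballCenter,
    ballRight, matQ, ← inv_one_add_conjTranspose_mul_inv_mul _ hP, nonsing_inv_nonsing_inv _ hB,
    ← sub_eq_add_neg]

theorem ballRight_posDef {z : Fin n → ℂ} {w : Fin n → Matrix (Fin k) (Fin k) ℂ}
    (hP : (pick z w).PosDef) : (ballRight z w).PosDef := by
  rw [ballRight, matQ, ← inv_one_add_conjTranspose_mul_inv_mul _ hP]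
  exact (posDef_one_add_conjTranspose_mul_inv_mul _ hP).inv

/-- Positivity of `extPick` puts `X ⊕ X` in the ball centered at `-C`, whereas `ballPoint` is
centered at `C`. Negating both `X` and `K` passes between the two. -/
theorem exists_ballPoint_iff_exists_extPick_posSemidef {z : Fin n → ℂ}
    {w : Fin n → Matrix (Fin k) (Fin k) ℂ} (hP : (pick z w).PosDef) (hM : IsUnit (matM z w)) :
    ((matLambda z w).PosDef ∧ ∃ K : Matrix (Fin k ⊕ Fin k) (Fin k ⊕ Fin k) ℂ,
      IsContractive K ∧ ∃ X : Matrix (Fin k) (Fin k) ℂ,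
        ballPoint z w K = fromBlocks X 0 0 X) ↔ ∃ X, (extPick z w X).PosSemidef := by
  have hR := ballRight_posDef hP
  constructor
  · rintro ⟨hL, K, hK, X, hX⟩
    refine ⟨-X, ?_⟩
    rw [extPick_posSemidef_iff hP, ← exists_isContractive_iff_posSemidef hL hR]
    refine ⟨-K, (isContractive_neg_iff K).2 hK, ?_⟩
    have h1 : fromBlocks (-X) 0 0 (-X) = -fromBlocks X 0 0 X := by simp [fromBlocks_neg]
    rw [h1, ← hX, ballPoint, ballLeft]
    simp
  · rintro ⟨X, hX⟩
    rw [extPick_posSemidef_iff hP] at hX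
    -- `Λ` is the Schur complement plus a positive semidefinite term, so it is positive
    -- semidefinite. Invertibility of `M` excludes a kernel.
    have hL : (matLambda z w).PosDef := by
      have h0 := (hR.inv.posSemidef).mul_mul_conjTranspose_same
        (fromBlocks X 0 0 X + ballCenter z w)
      have h1 := hX.add h0
      rw [sub_add_cancel] at h1
      exact h1.posDef_iff_isUnit.2 ((isUnit_fromBlocks_ball_iff _ _ hP).1 hM)
    refine ⟨hL, ?_⟩
    obtain ⟨K, hK, h⟩ := (exists_isContractive_iff_posSemidef hL hR _).2 hX
    refine ⟨-K, (isContractive_neg_iff K).2 hK, -X, ?_⟩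
    have h1 : fromBlocks (-X) 0 0 (-X) = -fromBlocks X 0 0 X := by simp [fromBlocks_neg]
    rw [h1, ballPoint, ballLeft, Matrix.mul_neg, Matrix.neg_mul, h]
    abel

end ExtendedPick

/-! ### Transfer functions of unitary colligations -/

section TransferFunction

variable {N : Type} [Fintype N] [DecidableEq N] {k : ℕ}

/-- The transfer function of the system with colligation `fromBlocks a b c d`. -/
noncomputable def transferFunction (a : Matrix N N ℂ) (b : Matrix N (Fin k) ℂ)
    (c : Matrix (Fin k) N ℂ) (d : Matrix (Fin k) (Fin k) ℂ) (z : ℂ) :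
    Matrix (Fin k) (Fin k) ℂ :=
  d + z • (c * (1 - z • a)⁻¹ * b)

variable {a : Matrix N N ℂ} {b : Matrix N (Fin k) ℂ} {c : Matrix (Fin k) N ℂ}
  {d : Matrix (Fin k) (Fin k) ℂ}

/-- The corner `a` of an isometry is a contraction, so `v = z • a v` with `‖z‖ < 1` forces `v = 0`.
-/
theorem isUnit_det_one_sub_smul (h : (fromBlocks a b c d)ᴴ * fromBlocks a b c d = 1)
    {z : ℂ} (hz : ‖z‖ < 1) : IsUnit (1 - z • a).det := by
  have ha : (1 - aᴴ * a).PosSemidef := by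
    rw [fromBlocks_conjTranspose, fromBlocks_multiply, ← fromBlocks_one, fromBlocks_inj] at h
    rw [← h.1, add_sub_cancel_left]
    exact posSemidef_conjTranspose_mul_self c
  rw [← isContractive_iff_conjTranspose_mul_self, IsContractive] at ha
  rw [isUnit_iff_ne_zero]
  intro h0
  obtain ⟨v, hv, hv0⟩ := exists_mulVec_eq_zero_iff.2 h0
  rw [sub_mulVec, one_mulVec, sub_eq_zero, smul_mulVec] at hv0
  have h1 : ‖WithLp.toLp 2 (a *ᵥ v)‖ ≤ ‖WithLp.toLp 2 v‖ := by
    simpa using (toEuclideanCLM (n := N) (𝕜 := ℂ) a).le_of_opNorm_le ha (WithLp.toLp 2 v)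
  have h2 : ‖WithLp.toLp 2 v‖ = ‖z‖ * ‖WithLp.toLp 2 (a *ᵥ v)‖ := by
    rw [← norm_smul, ← WithLp.toLp_smul, ← hv0]
  have h3 : 0 < ‖WithLp.toLp 2 v‖ := by simpa using hv
  nlinarith [norm_nonneg z, norm_nonneg (WithLp.toLp 2 (a *ᵥ v))]

/-- Energy balance: the colligation maps the column `(z x, 1)` to `(x, S z)`, where `x = (1 - z a)⁻¹
b`. Equality of the two Gram matrices gives `1 - (S z)ᴴ * S z = (1 - ‖z‖²) xᴴ x`. -/
theorem isContractive_transferFunction (h : (fromBlocks a b c d)ᴴ * fromBlocks a b c d = 1)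
    {z : ℂ} (hz : ‖z‖ < 1) : IsContractive (transferFunction a b c d z) := by
  have hu := isUnit_det_one_sub_smul h hz
  set x := (1 - z • a)⁻¹ * b with hx
  have h1 : z • (a * x) + b = x := by
    have : (1 - z • a) * x = b := by rw [hx, ← Matrix.mul_assoc, mul_nonsing_inv _ hu, Matrix.one_mul]
    rw [Matrix.sub_mul, Matrix.one_mul, Matrix.smul_mul] at this
    rw [← this]; abel
  have h2 : transferFunction a b c d z = z • (c * x) + d := by
    rw [transferFunction, add_comm, Matrix.mul_assoc]
  let x1 : Matrix (N ⊕ Fin k) (Fin k) ℂ := fromRows (z • x) 1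
  let x2 : Matrix (N ⊕ Fin k) (Fin k) ℂ := fromRows x (transferFunction a b c d z)
  have h3 : fromBlocks a b c d * x1 = x2 := by
    change _ = fromRows x (transferFunction a b c d z)
    rw [fromBlocks_mul_fromRows, h2]
    simp [h1]
  have h4 : x2ᴴ * x2 = x1ᴴ * x1 := by
    rw [← h3, conjTranspose_mul, Matrix.mul_assoc, ← Matrix.mul_assoc _ (fromBlocks a b c d), h,
      Matrix.one_mul]
  rw [conjTranspose_fromRows_eq_fromCols_conjTranspose,
    conjTranspose_fromRows_eq_fromCols_conjTranspose, fromCols_mul_fromRows,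
    fromCols_mul_fromRows] at h4
  rw [isContractive_iff_conjTranspose_mul_self]
  have h5 : 1 - (transferFunction a b c d z)ᴴ * transferFunction a b c d z =
      ((1 - ‖z‖ ^ 2 : ℝ) : ℂ) • (xᴴ * x) := by
    have h6 : (z • x)ᴴ * (z • x) = (‖z‖ ^ 2 : ℂ) • (xᴴ * x) := by
      rw [conjTranspose_smul, Matrix.smul_mul, Matrix.mul_smul, smul_smul, ← Complex.conj_mul']
      rfl
    rw [h6] at h4
    push_cast
    rw [sub_smul, one_smul, sub_eq_sub_iff_add_eq_add, h4]
    simp [add_comm]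
  rw [h5]
  refine (posSemidef_conjTranspose_mul_self x).smul ?_
  have : ‖z‖ ^ 2 ≤ 1 := pow_le_one₀ (norm_nonneg _) hz.le
  exact_mod_cast sub_nonneg.2 this

theorem differentiableAt_det {M : ℂ → Matrix N N ℂ} {z : ℂ}
    (hM : ∀ i j, DifferentiableAt ℂ (fun z => M z i j) z) :
    DifferentiableAt ℂ (fun z => (M z).det) z := by
  simp only [det_apply']
  exact DifferentiableAt.fun_sum fun σ _ =>
    (DifferentiableAt.fun_finsetProd fun i _ => hM (σ i) i).const_mul _

theorem differentiableAt_inv_one_sub_smul {z : ℂ} (hu : IsUnit (1 - z • a).det) (i j : N) :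
    DifferentiableAt ℂ (fun z : ℂ => (1 - z • a)⁻¹ i j) z := by
  have hentry (i j : N) : DifferentiableAt ℂ (fun z : ℂ => (1 - z • a) i j) z := by
    simp only [Matrix.sub_apply, Matrix.smul_apply, smul_eq_mul]
    fun_prop
  simp only [inv_def, Matrix.smul_apply, Ring.inverse_eq_inv', adjugate_apply, smul_eq_mul]
  refine ((differentiableAt_det hentry).fun_inv hu.ne_zero).mul
    (differentiableAt_det fun i' j' => ?_)
  by_cases hij : i' = j
  · subst hij
    simp only [updateRow_self]
    fun_prop
  · simp only [updateRow_ne hij]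
    exact hentry i' j'

theorem differentiableAt_mul_inv_one_sub_smul_mul {z : ℂ} (hu : IsUnit (1 - z • a).det)
    (i j : Fin k) : DifferentiableAt ℂ (fun z : ℂ => (c * (1 - z • a)⁻¹ * b) i j) z := by
  simp only [Matrix.mul_apply]
  exact DifferentiableAt.fun_sum fun q _ => (DifferentiableAt.fun_sum fun p _ =>
    (differentiableAt_inv_one_sub_smul hu p q).const_mul _).mul_const _

/-- The derivative of the transfer function at the origin is `c * b`. -/
theorem transferFunction_mem_constrainedSchurClass
    (h : (fromBlocks a b c d)ᴴ * fromBlocks a b c d = 1) (hcb : c * b = 0) :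
    transferFunction a b c d ∈ constrainedSchurClass k := by
  refine ⟨fun i j z hz => ?_, fun z hz => ?_, fun i j => ?_⟩
  · have := differentiableAt_mul_inv_one_sub_smul_mul (b := b) (c := c)
      (isUnit_det_one_sub_smul h (mem_ball_zero_iff.1 hz)) i j
    simp only [transferFunction, Matrix.add_apply, Matrix.smul_apply, smul_eq_mul]
    exact ((differentiableAt_id.mul this).const_add _).differentiableWithinAt
  · exact isContractive_transferFunction h (mem_ball_zero_iff.1 hz)
  · have := differentiableAt_mul_inv_one_sub_smul_mul (b := b) (c := c)
      (isUnit_det_one_sub_smul h (z := 0) (by simp)) i j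
    simp only [transferFunction, Matrix.add_apply, Matrix.smul_apply, smul_eq_mul]
    have h2 := ((hasDerivAt_id (0 : ℂ)).mul this.hasDerivAt).const_add (d i j)
    simpa [hcb] using h2.deriv

end TransferFunction

/-! ### Sufficiency: the lurking isometry -/

section Realization

variable {n k : ℕ}

/-- The main diagonal operator of the Stein equation of the extended Pick matrix. -/
noncomputable def extZ (k : ℕ) (z : Fin n → ℂ) :
    Matrix ((Fin n × Fin k) ⊕ (Fin k ⊕ Fin k)) ((Fin n × Fin k) ⊕ (Fin k ⊕ Fin k)) ℂ :=
  fromBlocks (matZ k z) 0 0 (fromBlocks 0 0 1 0)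

theorem extPick_eq_fromBlocks (z : Fin n → ℂ) (w : Fin n → Matrix (Fin k) (Fin k) ℂ)
    (X : Matrix (Fin k) (Fin k) ℂ) :
    extPick z w X = fromBlocks (pick z w)
      (fromCols (matE n k - matW w * Xᴴ) (matZ k z * (matE n k - matW w * Xᴴ)))
      (fromCols (matE n k - matW w * Xᴴ) (matZ k z * (matE n k - matW w * Xᴴ)))ᴴ
      (fromBlocks (1 - X * Xᴴ) 0 0 (1 - X * Xᴴ)) := by
  have hcross : tildeE k z - tildeW z w * (fromBlocks X 0 0 X)ᴴ =
      fromCols (matE n k - matW w * Xᴴ) (matZ k z * (matE n k - matW w * Xᴴ)) := by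
    rw [tildeE, tildeW, fromBlocks_conjTranspose, fromCols_mul_fromBlocks, Matrix.mul_sub]
    ext i (j | j) <;> simp [Matrix.mul_assoc]
  have hcorner : 1 - fromBlocks X 0 0 X * (fromBlocks X 0 0 X)ᴴ =
      fromBlocks (1 - X * Xᴴ) 0 0 (1 - X * Xᴴ) := by
    rw [fromBlocks_conjTranspose, fromBlocks_multiply, ← fromBlocks_one, sub_eq_add_neg,
      fromBlocks_neg, fromBlocks_add]
    simp [sub_eq_add_neg]
  rw [extPick, hcross, hcorner]

/-- The nilpotent block of `extZ` treats the origin as a node of multiplicity two. The columns `(X,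
0)` and `(1, 0)` list the Taylor coefficients of `S` and of the constant `1` there. -/
theorem extPick_stein {z : Fin n → ℂ} (hz : ∀ i, ‖z i‖ < 1)
    (w : Fin n → Matrix (Fin k) (Fin k) ℂ) (X : Matrix (Fin k) (Fin k) ℂ) :
    extPick z w X + fromRows (matW w) (fromRows X 0) * (fromRows (matW w) (fromRows X 0))ᴴ =
      extZ k z * extPick z w X * (extZ k z)ᴴ +
        fromRows (matE n k) (fromRows 1 0) * (fromRows (matE n k) (fromRows 1 0))ᴴ := by
  have hpick : pick z w + matW w * (matW w)ᴴ =
      matZ k z * pick z w * (matZ k z)ᴴ + matE n k * (matE n k)ᴴ := by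
    ext ⟨i, p⟩ ⟨j, q⟩
    have h0 : 1 - z i * star (z j) ≠ 0 := by
      intro h
      have h1 : ‖z i * star (z j)‖ < 1 := by
        rw [norm_mul, norm_star]
        exact mul_lt_one_of_nonneg_of_lt_one_left (norm_nonneg _) (hz i) (hz j).le
      rw [← sub_eq_zero.1 h, norm_one] at h1
      exact lt_irrefl _ h1
    have h1 : (matW w * (matW w)ᴴ) (i, p) (j, q) = (w i * (w j)ᴴ) p q := by
      simp [matW, Matrix.mul_apply]
    have h2 : (matE n k * (matE n k)ᴴ) (i, p) (j, q) = (1 : Matrix (Fin k) (Fin k) ℂ) p q := by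
      have : (matE n k * (matE n k)ᴴ) (i, p) (j, q) =
          ((1 : Matrix (Fin k) (Fin k) ℂ) * (1 : Matrix (Fin k) (Fin k) ℂ)ᴴ) p q := by
        simp only [matE, Matrix.mul_apply, conjTranspose_apply, of_apply]
      rw [this, conjTranspose_one, Matrix.one_mul]
    rw [Matrix.add_apply, Matrix.add_apply, h1, h2, matZ, diagonal_conjTranspose, mul_diagonal,
      diagonal_mul]
    simp only [pick, of_apply, Pi.star_apply, Matrix.sub_apply]
    field_simp
    ring
  rw [extPick_eq_fromBlocks, extZ]
  simp only [conjTranspose_fromRows_eq_fromCols_conjTranspose, fromRows_mul_fromCols,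
    conjTranspose_fromCols_eq_fromRows_conjTranspose,
    fromBlocks_conjTranspose, fromBlocks_multiply, fromBlocks_add, fromBlocks_inj]
  refine ⟨by simpa using hpick, ?_, ?_, ?_⟩
  · simp only [conjTranspose_zero, conjTranspose_one, Matrix.zero_mul, add_zero,
      fromCols_mul_fromBlocks, mul_fromCols, Matrix.mul_zero, Matrix.mul_one, zero_add]
    ext i (j | j) <;> simp
  · simp only [conjTranspose_zero, fromBlocks_mul_fromRows, fromRows_mul, Matrix.mul_zero,
      Matrix.zero_mul, Matrix.one_mul, add_zero, zero_add]
    ext (i | i) j <;> simp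
  · simp [fromBlocks_multiply, fromBlocks_add]

theorem mcnpSolvable_of_extPick_posSemidef {z : Fin n → ℂ} (hz : ∀ i, ‖z i‖ < 1)
    {w : Fin n → Matrix (Fin k) (Fin k) ℂ} {X : Matrix (Fin k) (Fin k) ℂ}
    (h : (extPick z w X).PosSemidef) : MCNPSolvable z w := by
  obtain ⟨G, hG⟩ : ∃ G, extPick z w X = G * Gᴴ := by
    obtain ⟨B, hB⟩ := CStarAlgebra.nonneg_iff_eq_star_mul_self.1 (nonneg_iff_posSemidef.2 h)
    exact ⟨Bᴴ, by rw [hB, conjTranspose_conjTranspose]; rfl⟩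
  have hS := extPick_stein hz w X
  obtain ⟨U, hU, hU2⟩ := exists_unitary_of_mul_conjTranspose_eq
    (fromCols G (fromRows (matW w) (fromRows X 0)))
    (fromCols (extZ k z * G) (fromRows (matE n k) (fromRows 1 0))) (by
      rw [conjTranspose_fromCols_eq_fromRows_conjTranspose,
        conjTranspose_fromCols_eq_fromRows_conjTranspose, fromCols_mul_fromRows,
        fromCols_mul_fromRows, ← hG, hS, hG, conjTranspose_mul]
      simp only [Matrix.mul_assoc])
  obtain ⟨a, b, c, d, rfl⟩ : ∃ a b c d, U = fromBlocks a b c d :=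
    ⟨_, _, _, _, (fromBlocks_toBlocks U).symm⟩
  obtain ⟨g, g0, g1, rfl⟩ : ∃ g g0 g1, G = fromRows g (fromRows g0 g1) :=
    ⟨G.toRows₁, G.toRows₂.toRows₁, G.toRows₂.toRows₂, by simp⟩
  rw [fromCols_mul_fromBlocks, extZ, fromBlocks_mul_fromRows, fromBlocks_mul_fromRows] at hU2
  have hadd {p q r : Type} (A A' : Matrix p r ℂ) (B B' : Matrix q r ℂ) :
      fromRows A B + fromRows A' B' = fromRows (A + A') (B + B') := by
    ext (i | i) j <;> rfl
  simp only [fromRows_mul, hadd, fromCols_inj.eq_iff, fromRows_inj.eq_iff, Matrix.zero_mul,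
    Matrix.one_mul, add_zero, zero_add] at hU2
  obtain ⟨⟨hg, hg0, hg1⟩, hw, hX, h0⟩ := hU2
  -- The rows at the origin read `c = g0`, `d = X`, `g0 * a = g1` and `g0 * b = 0`. Hence `c * b =
  -- 0`, which is the derivative condition.
  subst hg0
  refine ⟨_, transferFunction_mem_constrainedSchurClass hU h0, fun j => ?_⟩
  have hu := isUnit_det_one_sub_smul hU (hz j)
  let gj : Matrix (Fin k) ((Fin n × Fin k) ⊕ (Fin k ⊕ Fin k)) ℂ := g.submatrix (fun p => (j, p)) id
  have hrow {l : Type} (y : Matrix ((Fin n × Fin k) ⊕ (Fin k ⊕ Fin k)) l ℂ)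
      (x : Matrix (Fin k) l ℂ) (v : Matrix (Fin n × Fin k) l ℂ)
      (h : matZ k z * g * y + matE n k * x = v) (p : Fin k) (q : l) :
      z j * (gj * y) p q + x p q = v (j, p) q := by
    have hx : (matE n k * x) (j, p) q = ((1 : Matrix (Fin k) (Fin k) ℂ) * x) p q := rfl
    rw [← h, Matrix.add_apply, hx, Matrix.one_mul, matZ, Matrix.mul_assoc, diagonal_mul]
    rfl
  -- The row of node `j` reads `z j • gj * a + c = gj` and `z j • gj * b + d = w j`. Eliminating
  -- `gj` yields the transfer function at `z j`.
  have h1 : gj * (1 - z j • a) = c := by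
    ext p q
    have := hrow a c g hg p q
    rw [Matrix.mul_sub, Matrix.mul_one, Matrix.mul_smul, Matrix.sub_apply, Matrix.smul_apply,
      smul_eq_mul, sub_eq_iff_eq_add', this]
    rfl
  have h2 : z j • (gj * b) + d = w j := by
    ext p q
    exact hrow b d (matW w) hw p q
  have h3 : c * (1 - z j • a)⁻¹ = gj := by
    rw [← h1, mul_nonsing_inv_cancel_right _ _ hu]
  rw [transferFunction, h3, add_comm, h2]

end Realization

open Real Metric

/-! ### Positivity of circle averages -/

section CircleAverage

theorem circleIntegrable_clm_comp {E F : Type} [NormedAddCommGroup E] [NormedSpace ℝ E]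
    [NormedAddCommGroup F] [NormedSpace ℝ F] (L : E →L[ℝ] F) {f : ℂ → E} {c : ℂ} {R : ℝ}
    (hf : CircleIntegrable f c R) : CircleIntegrable (fun ζ => L (f ζ)) c R :=
  ⟨L.integrable_comp hf.1, L.integrable_comp hf.2⟩

theorem circleAverage_star {f : ℂ → ℂ} {c : ℂ} {R : ℝ} (hf : CircleIntegrable f c R) :
    circleAverage (fun ζ => star (f ζ)) c R = star (circleAverage f c R) :=
  Complex.conjCLE.toContinuousLinearMap.circleAverage_comp_comm hf

theorem circleAverage_complex_nonneg {f : ℂ → ℂ} {c : ℂ} {R : ℝ} (hf : CircleIntegrable f c R)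
    (h : ∀ ζ ∈ sphere c |R|, 0 ≤ f ζ) : 0 ≤ circleAverage f c R := by
  have hre : CircleIntegrable (fun ζ => (f ζ).re) c R :=
    circleIntegrable_clm_comp Complex.reCLM hf
  have h1 : circleAverage f c R = ((circleAverage (fun ζ => (f ζ).re) c R : ℝ) : ℂ) := by
    rw [← Complex.ofRealCLM_apply, ← Complex.ofRealCLM.circleAverage_comp_comm hre]
    refine circleAverage_congr_sphere fun ζ hζ => ?_
    exact Complex.eq_re_of_ofReal_le (r := 0) (by simpa using h ζ hζ)
  rw [h1]
  exact_mod_cast circleAverage_nonneg_of_nonneg fun ζ hζ => (Complex.le_def.1 (h ζ hζ)).1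

theorem posSemidef_circleAverage {ι : Type} [Fintype ι] {F : ℂ → Matrix ι ι ℂ} {c : ℂ} {R : ℝ}
    (hF : ∀ i j, CircleIntegrable (fun ζ => F ζ i j) c R)
    (h : ∀ ζ ∈ sphere c |R|, (F ζ).PosSemidef) :
    (Matrix.of fun i j => circleAverage (fun ζ => F ζ i j) c R).PosSemidef := by
  refine .of_dotProduct_mulVec_nonneg ?_ fun x => ?_
  · ext i j
    rw [conjTranspose_apply, of_apply, of_apply, ← circleAverage_star (hF j i)]
    exact circleAverage_congr_sphere fun ζ hζ => (h ζ hζ).1.apply i j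
  · have hint : ∀ i ∈ (Finset.univ : Finset ι), ∀ j ∈ (Finset.univ : Finset ι),
        CircleIntegrable (fun ζ => (star (x i) * x j) • F ζ i j) c R :=
      fun i _ j _ => (hF i j).const_smul
    have h1 : star x ⬝ᵥ ((Matrix.of fun i j => circleAverage (fun ζ => F ζ i j) c R) *ᵥ x) =
        circleAverage (fun ζ => star x ⬝ᵥ (F ζ *ᵥ x)) c R := by
      have h2 : (fun ζ => star x ⬝ᵥ (F ζ *ᵥ x)) =
          fun ζ => ∑ i, ∑ j, (star (x i) * x j) • F ζ i j := by
        funext ζ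
        simp only [dotProduct, mulVec, Finset.mul_sum, Pi.star_apply, smul_eq_mul]
        exact Finset.sum_congr rfl fun i _ => Finset.sum_congr rfl fun j _ => by ring
      rw [h2, circleAverage_fun_sum fun i hi => CircleIntegrable.fun_sum _ (hint i hi)]
      simp only [dotProduct, mulVec, Finset.mul_sum, Pi.star_apply]
      refine Finset.sum_congr rfl fun i hi => ?_
      rw [circleAverage_fun_sum (hint i hi)]
      refine Finset.sum_congr rfl fun j _ => ?_
      rw [circleAverage_fun_smul, of_apply, smul_eq_mul]
      ring
    rw [h1]
    refine circleAverage_complex_nonneg ?_ fun ζ hζ => (h ζ hζ).dotProduct_mulVec_nonneg x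
    simp only [dotProduct, mulVec, Finset.mul_sum]
    refine CircleIntegrable.fun_sum _ fun i hi => CircleIntegrable.fun_sum _ fun j hj => ?_
    convert hint i hi j hj using 2
    simp only [Pi.star_apply, smul_eq_mul]
    ring

end CircleAverage

/-! ### Szegő kernels and positivity of the Pick kernel -/

section SzegoKernel

variable {n k : ℕ}

/-- The functionals `u ↦ u (z i)`, `u ↦ u 0` and `u ↦ u' 0`. -/
noncomputable def evalFunctional (z : Fin n → ℂ) : Fin n ⊕ (Unit ⊕ Unit) → (ℂ → ℂ) → ℂ
  | .inl i => fun u => u (z i)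
  | .inr (.inl _) => fun u => u 0
  | .inr (.inr _) => fun u => deriv u 0

/-- The functions representing the functionals `evalFunctional` on the Hardy space. -/
noncomputable def szegoKernel (z : Fin n → ℂ) : Fin n ⊕ (Unit ⊕ Unit) → ℂ → ℂ
  | .inl i => fun ζ => (1 - star (z i) * ζ)⁻¹
  | .inr (.inl _) => fun _ => 1
  | .inr (.inr _) => fun ζ => ζ

theorem one_sub_star_mul_ne_zero {a ζ : ℂ} {ρ : ℝ} (ha : ‖a‖ * ρ < 1) (hζ : ‖ζ‖ < ρ) :
    1 - star a * ζ ≠ 0 := by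
  intro h
  have h1 : ‖star a * ζ‖ < 1 := by
    rw [norm_mul, norm_star]
    exact (mul_le_mul_of_nonneg_left hζ.le (norm_nonneg _)).trans_lt ha
  rw [← sub_eq_zero.1 h, norm_one] at h1
  exact lt_irrefl _ h1

theorem differentiableOn_szegoKernel {z : Fin n → ℂ} {ρ : ℝ} (hz : ∀ i, ‖z i‖ * ρ < 1)
    (a : Fin n ⊕ (Unit ⊕ Unit)) : DifferentiableOn ℂ (szegoKernel z a) (ball 0 ρ) := by
  rcases a with i | (_ | _) <;> simp only [szegoKernel]
  · refine DifferentiableOn.fun_inv (by fun_prop) fun ζ hζ => ?_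
    exact one_sub_star_mul_ne_zero (hz i) (mem_ball_zero_iff.1 hζ)
  · fun_prop
  · fun_prop

/-- On the unit circle `star ζ = ζ⁻¹`, so the three cases are Cauchy's formula, the mean value
property and Cauchy's formula for the derivative. -/
theorem circleAverage_star_szegoKernel_mul {z : Fin n → ℂ} {ρ : ℝ} (hρ : 1 < ρ)
    (hz : ∀ i, ‖z i‖ * ρ < 1) {u : ℂ → ℂ} (hu : DifferentiableOn ℂ u (ball 0 ρ))
    (a : Fin n ⊕ (Unit ⊕ Unit)) :
    circleAverage (fun ζ => star (szegoKernel z a ζ) * u ζ) 0 1 = evalFunctional z a u := by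
  have hsub : closedBall (0 : ℂ) 1 ⊆ ball 0 ρ := closedBall_subset_ball hρ
  have hd : DiffContOnCl ℂ u (ball 0 |1|) :=
    (hu.mono (by rwa [abs_one, closure_ball _ one_ne_zero])).diffContOnCl
  have hconj {ζ : ℂ} (hζ : ζ ∈ sphere (0 : ℂ) |1|) : ζ ≠ 0 ∧ star ζ = ζ⁻¹ := by
    have h1 : ‖ζ‖ = 1 := by simpa using hζ
    refine ⟨norm_ne_zero_iff.1 (by rw [h1]; exact one_ne_zero), ?_⟩
    rw [Complex.inv_def, Complex.normSq_eq_norm_sq, h1]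
    simp
  rcases a with i | (_ | _) <;> simp only [szegoKernel, evalFunctional]
  · have hzi : ‖z i‖ < 1 := by nlinarith [hz i, norm_nonneg (z i)]
    rw [← hd.circleAverage_smul_div (w := z i) (by simpa using hzi)]
    refine circleAverage_congr_sphere fun ζ hζ => ?_
    obtain ⟨h0, h1⟩ := hconj hζ
    have h2 : ζ - z i ≠ 0 := by
      intro h
      rw [sub_eq_zero] at h
      rw [h] at hζ
      have : ‖z i‖ = 1 := by simpa using hζ
      exact hzi.ne this
    have h3 : 1 - z i * ζ⁻¹ = (ζ - z i) / ζ := by field_simp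
    simp only [star_inv₀, star_sub, star_one, star_mul', star_star, h1, h3, sub_zero, inv_div,
      smul_eq_mul]
  · rw [← hd.circleAverage]
    simp
  · rw [← Complex.two_pi_I_inv_smul_circleIntegral_sub_sq_inv_smul_of_differentiable
      isOpen_ball hsub hu (mem_ball_self one_pos), circleAverage_eq_circleIntegral one_ne_zero]
    congr 1
    refine circleIntegral.integral_congr zero_le_one fun ζ hζ => ?_
    obtain ⟨h0, h1⟩ := hconj (by rwa [abs_one])
    simp only [h1, sub_zero, smul_eq_mul]
    rw [← mul_assoc, pow_two, mul_inv]

/-- Because `S' 0 = 0`, the product rule makes the derivative functional see multiplication by `S`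
as multiplication by `S 0`. Both functionals at the origin thus carry the same symbol value. -/
theorem evalFunctional_mul {z : Fin n → ℂ} {S : ℂ → Matrix (Fin k) (Fin k) ℂ} {p r : Fin k}
    (hS : DifferentiableAt ℂ (fun z => S z p r) 0) (hS0 : deriv (fun z => S z p r) 0 = 0)
    {u : ℂ → ℂ} (hu : DifferentiableAt ℂ u 0) (a : Fin n ⊕ (Unit ⊕ Unit)) :
    evalFunctional z a (fun ζ => S ζ p r * u ζ) =
      (Sum.elim (fun i => S (z i)) (fun _ => S 0) a : Matrix (Fin k) (Fin k) ℂ) p r *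
        evalFunctional z a u := by
  rcases a with i | (_ | _) <;> simp only [evalFunctional, Sum.elim_inl, Sum.elim_inr]
  rw [deriv_fun_mul hS hu, hS0, zero_mul, zero_add]

/-- The Pick kernel matrix of the functionals `evalFunctional`, with symbol values `T`. -/
noncomputable def pickKernel (z : Fin n → ℂ)
    (T : Fin n ⊕ (Unit ⊕ Unit) → Matrix (Fin k) (Fin k) ℂ) :
    Matrix ((Fin n ⊕ (Unit ⊕ Unit)) × Fin k) ((Fin n ⊕ (Unit ⊕ Unit)) × Fin k) ℂ :=
  Matrix.of fun x y =>
    (1 - T x.1 * (T y.1)ᴴ) x.2 y.2 * evalFunctional z x.1 (szegoKernel z y.1)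

/-- With `G` the Gram matrix of the kernels, the averages of `Aᴴ A`, `Aᴴ S B` and `Bᴴ B` have
entries `G`, `T Tᴴ G` and `T Tᴴ G`. The combination in `hN` therefore averages to `(1 - T Tᴴ) G`. -/
theorem posSemidef_pickKernel {z : Fin n → ℂ} {ρ : ℝ} (hρ : 1 < ρ)
    (hz : ∀ i, ‖z i‖ * ρ < 1) {S : ℂ → Matrix (Fin k) (Fin k) ℂ}
    (hS : ∀ i j, DifferentiableOn ℂ (fun z => S z i j) (ball 0 ρ))
    (hc : ∀ ζ ∈ sphere (0 : ℂ) 1, IsContractive (S ζ))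
    (hS0 : ∀ i j, deriv (fun z => S z i j) 0 = 0) :
    (pickKernel z (Sum.elim (fun i => S (z i)) fun _ => S 0)).PosSemidef := by
  set T : Fin n ⊕ (Unit ⊕ Unit) → Matrix (Fin k) (Fin k) ℂ :=
    Sum.elim (fun i => S (z i)) fun _ => S 0 with hT
  have hball : ball (0 : ℂ) ρ ∈ nhds 0 := ball_mem_nhds _ (one_pos.trans hρ)
  have hsub : sphere (0 : ℂ) 1 ⊆ ball 0 ρ := sphere_subset_closedBall.trans
    (closedBall_subset_ball hρ)
  have hκ (a) := differentiableOn_szegoKernel hz a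
  have hκc (a) : ContinuousOn (szegoKernel z a) (sphere 0 1) := (hκ a).continuousOn.mono hsub
  have hSc (i j) : ContinuousOn (fun z => S z i j) (sphere 0 1) := (hS i j).continuousOn.mono hsub
  let A (ζ : ℂ) : Matrix (Fin k) ((Fin n ⊕ (Unit ⊕ Unit)) × Fin k) ℂ :=
    Matrix.of fun p x => szegoKernel z x.1 ζ * (1 : Matrix (Fin k) (Fin k) ℂ) p x.2
  let B (ζ : ℂ) : Matrix (Fin k) ((Fin n ⊕ (Unit ⊕ Unit)) × Fin k) ℂ :=
    Matrix.of fun p x => szegoKernel z x.1 ζ * (T x.1)ᴴ p x.2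
  have hN (ζ : ℂ) (hζ : ζ ∈ sphere (0 : ℂ) 1) :
      ((A ζ)ᴴ * A ζ - (A ζ)ᴴ * (S ζ * B ζ) - ((A ζ)ᴴ * (S ζ * B ζ))ᴴ +
        (B ζ)ᴴ * B ζ).PosSemidef := by
    -- The combination equals `(A - S B)ᴴ (A - S B) + Bᴴ (1 - Sᴴ S) B`.
    have h1 := (posSemidef_conjTranspose_mul_self (A ζ - S ζ * B ζ)).add
      (((isContractive_iff_conjTranspose_mul_self _).1 (hc ζ hζ)).conjTranspose_mul_mul_same (B ζ))
    convert h1 using 1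
    simp only [conjTranspose_sub, conjTranspose_mul, conjTranspose_conjTranspose, Matrix.sub_mul,
      Matrix.mul_sub, Matrix.mul_assoc, Matrix.one_mul]
    abel
  have hAe (ζ : ℂ) (p x) :
      A ζ p x = szegoKernel z x.1 ζ * (1 : Matrix (Fin k) (Fin k) ℂ) p x.2 := rfl
  have hBe (ζ : ℂ) (p x) : B ζ p x = szegoKernel z x.1 ζ * (T x.1)ᴴ p x.2 := rfl
  have hA (ζ : ℂ) {l : Type} (N : Matrix (Fin k) l ℂ) (x y) :
      ((A ζ)ᴴ * N) x y = star (szegoKernel z x.1 ζ) * N x.2 y := by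
    rw [Matrix.mul_apply, Finset.sum_eq_single x.2 _ (by simp)]
    · simp [A]
    · intro p _ hp
      simp [A, Matrix.one_apply_ne hp]
  have hAA (ζ : ℂ) (x y) : ((A ζ)ᴴ * A ζ) x y = (1 : Matrix (Fin k) (Fin k) ℂ) x.2 y.2 •
      (star (szegoKernel z x.1 ζ) * szegoKernel z y.1 ζ) := by
    rw [hA, hAe, smul_eq_mul]
    ring
  have hH (ζ : ℂ) (x y) : ((A ζ)ᴴ * (S ζ * B ζ)) x y = ∑ r, star (T y.1 y.2 r) •
      (star (szegoKernel z x.1 ζ) * (S ζ x.2 r * szegoKernel z y.1 ζ)) := by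
    rw [hA, Matrix.mul_apply, Finset.mul_sum]
    refine Finset.sum_congr rfl fun r _ => ?_
    rw [hBe, conjTranspose_apply, smul_eq_mul]
    ring
  have hBB (ζ : ℂ) (x y) : ((B ζ)ᴴ * B ζ) x y = (T x.1 * (T y.1)ᴴ) x.2 y.2 •
      (star (szegoKernel z x.1 ζ) * szegoKernel z y.1 ζ) := by
    rw [Matrix.mul_apply, Matrix.mul_apply, smul_eq_mul, Finset.sum_mul]
    refine Finset.sum_congr rfl fun r _ => ?_
    rw [conjTranspose_apply, hBe, hBe, star_mul', conjTranspose_apply, star_star]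
    ring
  have iG (a b) : CircleIntegrable (fun ζ => star (szegoKernel z a ζ) * szegoKernel z b ζ) 0 1 :=
    ContinuousOn.circleIntegrable zero_le_one ((hκc a).star.mul (hκc b))
  have iAA (x y) : CircleIntegrable (fun ζ => ((A ζ)ᴴ * A ζ) x y) 0 1 := by
    simp only [hAA]
    exact (iG _ _).const_smul
  have iBB (x y) : CircleIntegrable (fun ζ => ((B ζ)ᴴ * B ζ) x y) 0 1 := by
    simp only [hBB]
    exact (iG _ _).const_smul
  have iH' (x y : (Fin n ⊕ (Unit ⊕ Unit)) × Fin k) (r) : CircleIntegrable (fun ζ =>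
      star (T y.1 y.2 r) •
        (star (szegoKernel z x.1 ζ) * (S ζ x.2 r * szegoKernel z y.1 ζ))) 0 1 :=
    (ContinuousOn.circleIntegrable zero_le_one
      ((hκc _).star.mul ((hSc _ _).mul (hκc _)))).const_smul
  have iH (x y) : CircleIntegrable (fun ζ => ((A ζ)ᴴ * (S ζ * B ζ)) x y) 0 1 := by
    simp only [hH]
    exact CircleIntegrable.fun_sum _ fun r _ => iH' x y r
  have iHs (x y) : CircleIntegrable (fun ζ => star (((A ζ)ᴴ * (S ζ * B ζ)) x y)) 0 1 :=
    circleIntegrable_clm_comp Complex.conjCLE.toContinuousLinearMap (iH x y)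
  have aG (a b) : circleAverage (fun ζ => star (szegoKernel z a ζ) * szegoKernel z b ζ) 0 1 =
      evalFunctional z a (szegoKernel z b) := circleAverage_star_szegoKernel_mul hρ hz (hκ b) a
  have hG (a b) : star (evalFunctional z a (szegoKernel z b)) =
      evalFunctional z b (szegoKernel z a) := by
    rw [← aG, ← aG, ← circleAverage_star (iG a b)]
    simp only [star_mul', star_star, mul_comm]
  have aH (x y) : circleAverage (fun ζ => ((A ζ)ᴴ * (S ζ * B ζ)) x y) 0 1 =
      (T x.1 * (T y.1)ᴴ) x.2 y.2 * evalFunctional z x.1 (szegoKernel z y.1) := by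
    simp only [hH]
    rw [circleAverage_fun_sum fun r _ => iH' x y r, Matrix.mul_apply, Finset.sum_mul]
    refine Finset.sum_congr rfl fun r _ => ?_
    rw [circleAverage_fun_smul,
      circleAverage_star_szegoKernel_mul hρ hz ((hS x.2 r).fun_mul (hκ y.1)) x.1,
      evalFunctional_mul ((hS _ _).differentiableAt hball) (hS0 _ _)
        ((hκ _).differentiableAt hball), conjTranspose_apply, smul_eq_mul]
    ring
  have key := posSemidef_circleAverage (c := 0) (R := 1) (F := fun ζ =>
    (A ζ)ᴴ * A ζ - (A ζ)ᴴ * (S ζ * B ζ) - ((A ζ)ᴴ * (S ζ * B ζ))ᴴ + (B ζ)ᴴ * B ζ)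
    (fun x y => (((iAA x y).sub (iH x y)).sub (iHs y x)).add (iBB x y))
    (fun ζ hζ => hN ζ (by rwa [abs_one] at hζ))
  convert key using 1
  ext x y
  simp only [of_apply, Matrix.add_apply, Matrix.sub_apply, conjTranspose_apply, pickKernel]
  have i1 : CircleIntegrable (fun ζ => ((A ζ)ᴴ * A ζ) x y - ((A ζ)ᴴ * (S ζ * B ζ)) x y) 0 1 :=
    (iAA x y).sub (iH x y)
  have i2 : CircleIntegrable (fun ζ => ((A ζ)ᴴ * A ζ) x y - ((A ζ)ᴴ * (S ζ * B ζ)) x y -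
      star (((A ζ)ᴴ * (S ζ * B ζ)) y x)) 0 1 := i1.sub (iHs y x)
  rw [circleAverage_fun_add i2 (iBB x y),
    circleAverage_fun_sub i1 (iHs y x), circleAverage_fun_sub (iAA x y) (iH x y), circleAverage_star (iH y x), aH, aH]
  simp only [hAA, hBB]
  rw [circleAverage_fun_smul, circleAverage_fun_smul, aG, star_mul', hG, ← conjTranspose_apply,
    conjTranspose_mul, conjTranspose_conjTranspose, smul_eq_mul, smul_eq_mul]
  ring

/-- The index map identifying `extPick` with a Pick kernel matrix. -/
def pickIndex (n k : ℕ) : (Fin n × Fin k) ⊕ (Fin k ⊕ Fin k) → (Fin n ⊕ (Unit ⊕ Unit)) × Fin k :=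
  Sum.elim (fun x => (.inl x.1, x.2))
    (Sum.elim (fun p => (.inr (.inl ()), p)) fun p => (.inr (.inr ()), p))

theorem deriv_szegoKernel_inl (z : Fin n → ℂ) (j : Fin n) :
    deriv (szegoKernel z (.inl j)) 0 = star (z j) := by
  have h := ((hasDerivAt_id (0 : ℂ)).const_mul (star (z j))).const_sub 1
  exact (h.fun_inv (by simp)).deriv.trans (by simp)

theorem extPick_eq_submatrix (z : Fin n → ℂ) (w : Fin n → Matrix (Fin k) (Fin k) ℂ)
    (X : Matrix (Fin k) (Fin k) ℂ) :
    extPick z w X = (pickKernel z (Sum.elim w fun _ => X)).submatrix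
      (pickIndex n k) (pickIndex n k) := by
  have hK (i : Fin n) (p q : Fin k) :
      (matE n k - matW w * Xᴴ) (i, p) q = (1 - w i * Xᴴ) p q := rfl
  have hK' (i : Fin n) (p q : Fin k) :
      star ((1 - w i * Xᴴ) p q) = (1 - X * (w i)ᴴ) q p := by
    rw [← conjTranspose_apply, conjTranspose_sub, conjTranspose_one, conjTranspose_mul,
      conjTranspose_conjTranspose]
  rw [extPick_eq_fromBlocks]
  ext (⟨i, p⟩ | p | p) (⟨j, q⟩ | q | q) <;>
    simp only [submatrix_apply, pickIndex, Sum.elim_inl, Sum.elim_inr, pickKernel, of_apply,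
      fromBlocks_apply₁₁, fromBlocks_apply₁₂, fromBlocks_apply₂₁, fromBlocks_apply₂₂,
      conjTranspose_apply, fromCols_apply_inl, fromCols_apply_inr, matZ, diagonal_mul, star_mul',
      evalFunctional, deriv_szegoKernel_inl, hK', hK]
  all_goals simp [szegoKernel, pick, div_eq_mul_inv, mul_comm]

end SzegoKernel

/-! ### Necessity: dilation and passage to the limit -/

section Necessity

variable {n k : ℕ}

theorem posSemidef_of_tendsto {ι : Type} [Fintype ι] {α : Type} {l : Filter α} [l.NeBot]
    {F : α → Matrix ι ι ℂ} {M : Matrix ι ι ℂ}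
    (hF : Filter.Tendsto F l (nhds M)) (h : ∀ᶠ r in l, (F r).PosSemidef) : M.PosSemidef := by
  refine .of_dotProduct_mulVec_nonneg ?_ fun x => ?_
  · have h1 : Filter.Tendsto (fun r => (F r)ᴴ) l (nhds Mᴴ) :=
      (continuous_id.matrix_conjTranspose.tendsto M).comp hF
    refine tendsto_nhds_unique h1 (hF.congr' ?_)
    filter_upwards [h] with r hr using hr.1.symm
  · have h1 : Filter.Tendsto (fun r => star x ⬝ᵥ (F r *ᵥ x)) l (nhds (star x ⬝ᵥ (M *ᵥ x))) := by
      have : Continuous fun M : Matrix ι ι ℂ => star x ⬝ᵥ (M *ᵥ x) := by fun_prop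
      exact (this.tendsto M).comp hF
    refine ge_of_tendsto h1 ?_
    filter_upwards [h] with r hr using hr.dotProduct_mulVec_nonneg x

theorem continuousAt_evalFunctional_szegoKernel {z : Fin n → ℂ} (hz : ∀ i, ‖z i‖ < 1)
    (a b : Fin n ⊕ (Unit ⊕ Unit)) :
    ContinuousAt (fun r : ℝ => evalFunctional (fun i => z i / r)
      a (szegoKernel (fun i => z i / r) b)) 1 := by
  have hd (i : Fin n) : ContinuousAt (fun r : ℝ => z i / (r : ℂ)) 1 :=
    continuousAt_const.div Complex.continuous_ofReal.continuousAt (by simp)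
  rcases a with i | (_ | _) <;> rcases b with j | (_ | _) <;>
    simp only [evalFunctional, deriv_szegoKernel_inl]
  all_goals try simp only [szegoKernel]
  · refine ContinuousAt.inv₀ (continuousAt_const.sub ((hd j).star.mul (hd i))) ?_
    refine one_sub_star_mul_ne_zero (ρ := 1) ?_ ?_ <;> simpa using hz _
  · exact continuousAt_const
  · exact hd i
  · simpa using continuousAt_const
  · exact continuousAt_const
  · exact continuousAt_const
  · exact (hd j).star
  · exact continuousAt_const
  · exact continuousAt_const

/-- The dilate `ζ ↦ S (r * ζ)` is holomorphic past the closed disk and takes the same values at the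
nodes `z i / r`. The Pick kernel at these nodes is continuous in `r`, so positivity survives `r →
1`. -/
theorem extPick_posSemidef_of_mem_constrainedSchurClass {z : Fin n → ℂ} (hz : ∀ i, ‖z i‖ < 1)
    {S : ℂ → Matrix (Fin k) (Fin k) ℂ} (hS : S ∈ constrainedSchurClass k) :
    (extPick z (fun i => S (z i)) (S 0)).PosSemidef := by
  obtain ⟨hd, hc, h0⟩ := hS
  rw [extPick_eq_submatrix]
  refine PosSemidef.submatrix ?_ _
  set T : Fin n ⊕ (Unit ⊕ Unit) → Matrix (Fin k) (Fin k) ℂ :=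
    Sum.elim (fun i => S (z i)) fun _ => S 0 with hT
  have hlim : Filter.Tendsto (fun r : ℝ => pickKernel (fun i => z i / r) T)
      (nhdsWithin 1 (Set.Iio 1)) (nhds (pickKernel z T)) := by
    have h1 : ContinuousAt (fun r : ℝ => pickKernel (fun i => z i / r) T) 1 :=
      continuousAt_pi.2 fun x => continuousAt_pi.2 fun y =>
        (continuousAt_evalFunctional_szegoKernel hz x.1 y.1).const_mul _
    have h2 : pickKernel (fun i => z i / ((1 : ℝ) : ℂ)) T = pickKernel z T := by simp
    rw [← h2]
    exact h1.tendsto.mono_left nhdsWithin_le_nhds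
  refine posSemidef_of_tendsto hlim ?_
  -- The square comes from requiring `‖z i / r‖ * ρ < 1` with `ρ = r⁻¹`.
  have hev : ∀ᶠ r : ℝ in nhdsWithin 1 (Set.Iio 1), ∀ i, ‖z i‖ < r * r := by
    refine nhdsWithin_le_nhds (Filter.eventually_all.2 fun i => ?_)
    have : ContinuousAt (fun r : ℝ => r * r) 1 := by fun_prop
    exact this.tendsto.eventually_const_lt (by simpa using hz i)
  filter_upwards [hev, self_mem_nhdsWithin,
    nhdsWithin_le_nhds (lt_mem_nhds (zero_lt_one' ℝ))] with r hr hr1 hr0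
  have hr0' : (r : ℂ) ≠ 0 := by exact_mod_cast hr0.ne'
  have hmul {ζ : ℂ} (hζ : ‖ζ‖ < r⁻¹) : (r : ℂ) * ζ ∈ ball (0 : ℂ) 1 := by
    rw [mem_ball_zero_iff, norm_mul, Complex.norm_real, norm_of_nonneg hr0.le]
    calc r * ‖ζ‖ < r * r⁻¹ := mul_lt_mul_of_pos_left hζ hr0
      _ = 1 := mul_inv_cancel₀ hr0.ne'
  have h1r : 1 < r⁻¹ := (one_lt_inv₀ hr0).2 hr1
  have hTr : T = Sum.elim (fun i => S (r * (z i / r))) fun _ => S (r * 0) := by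
    simp only [mul_div_cancel₀ _ hr0', mul_zero, hT]
  rw [hTr]
  refine posSemidef_pickKernel (S := fun ζ => S (r * ζ)) h1r (fun i => ?_) (fun i j => ?_)
    (fun ζ hζ => ?_) fun i j => ?_
  · rw [norm_div, Complex.norm_real, norm_of_nonneg hr0.le, div_mul_eq_mul_div, ← div_eq_mul_inv,
      div_div, div_lt_one (by positivity)]
    exact hr i
  · exact (hd i j).comp (by fun_prop) fun ζ hζ => hmul (mem_ball_zero_iff.1 hζ)
  · exact hc _ (hmul (by rw [mem_sphere_zero_iff_norm.1 hζ]; exact h1r))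
  · rw [deriv_comp_mul_left (r : ℂ) (fun z => S z i j) 0, mul_zero, h0, smul_zero]

theorem mcnpSolvable_iff_exists_extPick_posSemidef {z : Fin n → ℂ} (hz : ∀ i, ‖z i‖ < 1)
    (w : Fin n → Matrix (Fin k) (Fin k) ℂ) :
    MCNPSolvable z w ↔ ∃ X, (extPick z w X).PosSemidef := by
  constructor
  · rintro ⟨S, hS, hw⟩
    obtain rfl : (fun i => S (z i)) = w := funext hw
    exact ⟨S 0, extPick_posSemidef_of_mem_constrainedSchurClass hz hS⟩
  · rintro ⟨X, hX⟩
    exact mcnpSolvable_of_extPick_posSemidef hz hX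

end Necessity

end ConstrainedNP

/-- Solvability criterion for the matrix-valued constrained Nevanlinna-Pick problem. -/
theorem theorem4p2 (n k : ℕ) (z : Fin n → ℂ) (w : Fin n → Matrix (Fin k) (Fin k) ℂ)
    (hz : ∀ i, ‖z i‖ < 1) (hz0 : ∀ i, z i ≠ 0) (hinj : Function.Injective z)
    (hP : (ConstrainedNP.pick z w).PosDef) (hM : IsUnit (ConstrainedNP.matM z w)) :
    ConstrainedNP.MCNPSolvable z w ↔
      (ConstrainedNP.matLambda z w).PosDef ∧
        ∃ K : Matrix (Fin k ⊕ Fin k) (Fin k ⊕ Fin k) ℂ, ConstrainedNP.IsContractive K ∧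
          ∃ X : Matrix (Fin k) (Fin k) ℂ,
            ConstrainedNP.ballPoint z w K = Matrix.fromBlocks X 0 0 X := by
  rw [ConstrainedNP.mcnpSolvable_iff_exists_extPick_posSemidef hz,
    ConstrainedNP.exists_ballPoint_iff_exists_extPick_posSemidef hP hM]
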